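/- **Theorem 5 (separation).** A one-dimensional cellular automaton is a biinfinite array of cells with states in a finite set $S$; at each step all cells are updated synchronously, the new state of a cell being a fixed function of its own state and the states of its two neighbors. There are two special states $0$ and $1$ and a different, stable neutral state; an input $w\in\{0,1\}^n$ is written in $n$ consecutive cells, and all other cells are neutral at the start. A predicate $P$ on binary strings is computable in linear time if there are a cellular automaton and a constant $C$ such that for every nonempty input $w$ the first input cell is in state $P(w)$ at all times $t\ge C|w|$. In the non-uniform model an arbitrary function $S^3\to S$, depending on $n$, on the cell and on the time, may be used at each vertex of the time-space diagram, and $S$ may depend on $n$. $P$ is computable "as soon as possible" in this model if the number of states $\#S$ that suffices to obtain, for all inputs $w$ of length $n$, the answer $P(w)$ (as the state $0$ or $1$) at time $\lfloor n/2\rfloor$ in a middle cell (a cell at distance at most $\lfloor n/2\rfloor$ from every input cell) is bounded by a constant that does not depend on $n\ge 2$. There exists a predicate $P$ on binary strings that is computable by a cellular automaton in linear time but is not computable "as soon as possible", even in the non-uniform model. Moreover, $P$ can be chosen to be the indexing predicate: for all $k$, $x,z\in\{0,1\}^k$ and $y\in\{0,1\}^{2^{2k}}$ (a row-by-row table of a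 function $\{0,1\}^k\times\{0,1\}^k\to\{0,1\}$), $$P(xyz)=y(x,z),$$ with suitable values on strings whose length is not of the form $2k+2^{2k}$; and no predicate that satisfies this equation, whatever its values on the other lengths, is computable "as soon as possible" in the non-uniform model. -/

import Mathlib

namespace CellAut

/-- Space-time diagram of a one-dimensional array of cells with states in `S`: the state of cell `i`
at time `t + 1` is obtained by the ternary function `δ t i` from the states of the cells
`i - 1`, `i`, `i + 1` at time `t`. -/
def evolve {S : Type} (δ : ℕ → ℤ → S → S → S → S) (init : ℤ → S) : ℕ → ℤ → S
  | 0 => init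
  | t + 1 => fun i =>
      δ t i (evolve δ init t (i - 1)) (evolve δ init t i) (evolve δ init t (i + 1))

/-- Initial configuration on the input `w`: the bits of `w`, encoded by `bit`, are written in the
cells `0, ..., w.length - 1`, and all the other cells of the biinfinite array are in state `q`. -/
def initial {S : Type} (bit : Bool → S) (q : S) (w : List Bool) : ℤ → S
  | Int.ofNat j => (w[j]?.map bit).getD q
  | Int.negSucc _ => q

/-- A (uniform) one-dimensional cellular automaton with two special states `0` (`bit false`) and
`1` (`bit true`) and a stable neutral state. -/
structure Automaton where
  /-- the set of states -/
  State : Type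
  finite_state : Finite State
  /-- the two special states -/
  bit : Bool → State
  /-- the neutral state -/
  neutral : State
  bit_injective : Function.Injective bit
  bit_ne_neutral : ∀ b, bit b ≠ neutral
  /-- new state of a cell from the states of its left neighbor, itself, its right neighbor -/
  rule : State → State → State → State
  rule_neutral : rule neutral neutral neutral = neutral

/-- State of cell `i` at time `t` in the computation of `A` on the input `w`. -/
def Automaton.run (A : Automaton) (w : List Bool) (t : ℕ) (i : ℤ) : A.State :=
  evolve (fun _ _ => A.rule) (initial A.bit A.neutral w) t i

/-- `P` is computable by a cellular automaton in linear time: there are one automaton and one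
constant `C` such that, on every nonempty input `w`, the first input cell contains the answer
(the special state `0` or `1`) from time `C * |w|` on. -/
def LinearTimeComputable (P : List Bool → Bool) : Prop :=
  ∃ (A : Automaton) (C : ℕ), ∀ w : List Bool, w ≠ [] →
    ∀ t : ℕ, C * w.length ≤ t → A.run w t 0 = A.bit (P w)

/-- `c` is a middle cell for inputs of length `n`: all the `n` input cells are at distance at most
`⌊n / 2⌋` from `c`. There is one such cell for odd `n`, and there are two for even `n > 0`. -/
def IsMiddle (n : ℕ) (c : ℤ) : Prop :=
  ∀ j : ℕ, j < n → |c - (j : ℤ)| ≤ ((n / 2 : ℕ) : ℤ)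

/-- The restriction of `P` to strings of length `n` is computable "as soon as possible" by a
non-uniform automaton with at most `s` states: an arbitrary ternary function is used in each vertex
of the space-time diagram, and the answer is in a middle cell at time `⌊n / 2⌋`. -/
def ASAPComputableWith (s n : ℕ) (P : List Bool → Bool) : Prop :=
  ∃ (S : Type) (_ : Fintype S) (bit : Bool → S) (q : S) (δ : ℕ → ℤ → S → S → S → S) (c : ℤ),
    Fintype.card S ≤ s ∧ Function.Injective bit ∧ IsMiddle n c ∧
      ∀ w : List Bool, w.length = n → evolve δ (initial bit q w) (n / 2) c = bit (P w)

/-- `P` is computable "as soon as possible" in the non-uniform model: the number of states needed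
for inputs of length `n` is bounded. (For `n < 2` no transition is made by time `⌊n / 2⌋`, so that
these lengths are not considered.) -/
def NonuniformASAPComputable (P : List Bool → Bool) : Prop :=
  ∃ s : ℕ, ∀ n : ℕ, 2 ≤ n → ASAPComputableWith s n P

/-- The number with the given binary digits, most significant digit first. -/
def binVal (l : List Bool) : ℕ :=
  l.foldl (fun v b => 2 * v + b.toNat) 0

/-- `P` is the indexing predicate `(x, y, z) ↦ y(x, z)` on strings `x y z` with `|x| = |z| = k` and
`|y| = 2 ^ (2 * k)`, for all `k`. Here `y` is the table, row by row, of a function of two `k`-bit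
strings: its value at `(x, z)` stands at the place whose number (counted from `0`) has the binary
notation `x z`. Nothing is said on strings of other lengths. -/
def IsIndexing (P : List Bool → Bool) : Prop :=
  ∀ (k : ℕ) (x y z : List Bool), x.length = k → y.length = 2 ^ (2 * k) → z.length = k →
    y[binVal (x ++ z)]? = some (P (x ++ y ++ z))

end CellAut

/-!
The lower bound is a counting argument. On an input `x y z` of the indexing problem with
`|x| = |z| = k` and `|y| = 2 * m`, the answer at time `m + k` is a function, fixed by the transition
functions, of the states of `2 * k + 1` cells at time `m`. By then the cells on the left of the
midpoint of `y` have not been reached by `z`, and the others have not been reached by `x`. So a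
table `y` is determined by two functions from `{0, 1} ^ k` to `S ^ (2 * k + 1)`. There are
`2 ^ 4 ^ k` tables, but only `2 ^ O(k * 2 ^ k)` such pairs of functions if `#S` is bounded
(`two_pow_le_of_asapComputableWith`, `IsIndexing.not_nonuniformASAPComputable`).

For the upper bound, a cellular automaton simulates a machine with several stacks, with the linear
slowdown `T ↦ 2 * T + 2`. The control is in the cell on the left of the input, and the cell `i`
contains the `i`-th entries of all the stacks, so that the input is a stack from the start. The
control sees the tops of the stacks. In every second step it issues a push or pop operation for each
stack; the operations travel to the right, and every cell that they pass shifts its entries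
accordingly (`StackMachine.Simulates`, `StackMachine.automaton_run_eq_bit`).

A stack machine solves the indexing problem in linear time. For a word of length `n` it finds
`k = ⌊log₄ n⌋` by repeated division of `n` by four in unary notation. It brings the first `k` and the
last `k` letters together, and converts this binary numeral, most significant digit first, into
unary notation by repeated doubling. Then it discards that many entries of the table. The times of
the divisions and of the doublings are dominated by geometric series with sums `O(n)`
(`indexer.reaches_log`, `indexer.exists_reaches_digit`, `indexer.exists_reaches_output`).
-/

namespace CellAut

/-! ### The indexing predicate is not computable as soon as possible -/

/-- A state depends only on the states in its cone of dependence at the earlier time `t₀`. -/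
lemma evolve_congr {S : Type} (δ : ℕ → ℤ → S → S → S → S) (init init' : ℤ → S) (t₀ : ℕ) :
    ∀ (t : ℕ) (i : ℤ),
      (∀ j, i - t ≤ j → j ≤ i + t → evolve δ init t₀ j = evolve δ init' t₀ j) →
      evolve δ init (t₀ + t) i = evolve δ init' (t₀ + t) i
  | 0, i, h => h i (by simp) (by simp)
  | t + 1, i, h => by
    have key : ∀ d : ℤ, -1 ≤ d → d ≤ 1 →
        evolve δ init (t₀ + t) (i + d) = evolve δ init' (t₀ + t) (i + d) := fun d h1 h2 =>
      evolve_congr δ init init' t₀ t _ fun j hj hj' =>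
        h j (by push_cast; linarith) (by push_cast; linarith)
    have h1 := key (-1) (by norm_num) (by norm_num)
    have h2 := key 0 (by norm_num) (by norm_num)
    have h3 := key 1 (by norm_num) (by norm_num)
    rw [← sub_eq_add_neg] at h1
    rw [add_zero] at h2
    rw [← add_assoc]
    simp only [evolve]
    rw [h1, h2, h3]

lemma initial_natCast {S : Type} (bit : Bool → S) (q : S) (w : List Bool) (j : ℕ) :
    initial bit q w (j : ℤ) = (w[j]?.map bit).getD q := rfl

lemma initial_congr {S : Type} (bit : Bool → S) (q : S) (w w' : List Bool) (i : ℤ)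
    (h : ∀ j : ℕ, (j : ℤ) = i → w[j]? = w'[j]?) : initial bit q w i = initial bit q w' i := by
  rcases i with j | j
  · simp only [initial, h j rfl]
  · rfl

lemma evolve_initial_congr {S : Type} (δ : ℕ → ℤ → S → S → S → S) (bit : Bool → S) (q : S)
    (w w' : List Bool) (t : ℕ) (i : ℤ)
    (h : ∀ j : ℕ, i - t ≤ j → (j : ℤ) ≤ i + t → w[j]? = w'[j]?) :
    evolve δ (initial bit q w) t i = evolve δ (initial bit q w') t i := by
  have := evolve_congr δ (initial bit q w) (initial bit q w') 0 t i fun j h1 h2 =>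
    initial_congr bit q w w' j fun l hl => h l (hl ▸ h1) (hl ▸ h2)
  simpa using this

lemma binVal_append_singleton (l : List Bool) (b : Bool) :
    binVal (l ++ [b]) = 2 * binVal l + b.toNat := by
  simp [binVal, List.foldl_append]

lemma binVal_lt (l : List Bool) : binVal l < 2 ^ l.length := by
  induction l using List.reverseRecOn with
  | nil => simp [binVal]
  | append_singleton l b ih =>
    rw [binVal_append_singleton, List.length_append, List.length_singleton, pow_succ]
    have := Bool.toNat_le b
    omega

lemma exists_binVal_eq (m : ℕ) : ∀ v < 2 ^ m, ∃ l : List Bool, l.length = m ∧ binVal l = v := by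
  induction m with
  | zero => intro v hv; exact ⟨[], rfl, by simp at hv; simp [binVal, hv]⟩
  | succ m ih =>
    intro v hv
    obtain ⟨l, hl, hv'⟩ := ih (v / 2) (by rw [pow_succ] at hv; omega)
    refine ⟨l ++ [decide (v % 2 = 1)], by simp [hl], ?_⟩
    rw [binVal_append_singleton, hv']
    rcases Nat.mod_two_eq_zero_or_one v with h | h <;> simp [h] <;> omega

/-- For inputs `x y z` of the indexing problem, the table `y` determines, for every `x`, the states
at time `2 ^ (2 * k - 1)` in the part of the cone of dependence of the answer that is out of reach
of `z`, and, for every `z`, the states in the part out of reach of `x`. Since these states in turn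
determine all the entries of `y`, there are at least as many of them as tables. -/
lemma two_pow_le_of_asapComputableWith {P : List Bool → Bool} (hP : IsIndexing P) {s k : ℕ}
    (hk : 1 ≤ k) (h : ASAPComputableWith s (2 * k + 2 ^ (2 * k)) P) :
    2 ^ 2 ^ (2 * k) ≤ ((s ^ (2 * k + 1)) ^ 2 ^ k) * ((s ^ (2 * k + 1)) ^ 2 ^ k) := by
  obtain ⟨S, _, bit, q, δ, c, hs, hbit, -, hw⟩ := h
  classical
  set m := 2 ^ (2 * k - 1) with hm
  have hN : 2 ^ (2 * k) = 2 * m := by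
    rw [hm, ← pow_succ']
    congr 1
    omega
  have hhalf : (2 * k + 2 ^ (2 * k)) / 2 = m + k := by omega
  rw [hhalf] at hw
  let word (x : Fin k → Bool) (y : Fin (2 ^ (2 * k)) → Bool) (z : Fin k → Bool) : List Bool :=
    List.ofFn x ++ List.ofFn y ++ List.ofFn z
  let zro : Fin k → Bool := fun _ => false
  let state (w : List Bool) (d : Fin (2 * k + 1)) : S := evolve δ (initial bit q w) m (c - k + d)
  let F (y : Fin (2 ^ (2 * k)) → Bool) :
      ((Fin k → Bool) → Fin (2 * k + 1) → S) × ((Fin k → Bool) → Fin (2 * k + 1) → S) :=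
    (fun x => state (word x y zro), fun z => state (word zro y z))
  have hF : Function.Injective F := by
    intro y y' hyy
    have hx : ∀ x, state (word x y zro) = state (word x y' zro) :=
      fun x => congrFun (congrArg Prod.fst hyy) x
    have hz : ∀ z, state (word zro y z) = state (word zro y' z) :=
      fun z => congrFun (congrArg Prod.snd hyy) z
    have left : ∀ x y z, ∀ j : ℤ, j < k + m →
        evolve δ (initial bit q (word x y z)) m j =
          evolve δ (initial bit q (word x y zro)) m j := by
      intro x y z j hj
      refine evolve_initial_congr δ bit q _ _ m j fun l _ hl => ?_
      have : l < (List.ofFn x ++ List.ofFn y).length := by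
        simp only [List.length_append, List.length_ofFn]
        omega
      rw [List.getElem?_append_left this, List.getElem?_append_left this]
    have right : ∀ x y z, ∀ j : ℤ, k + m ≤ j →
        evolve δ (initial bit q (word x y z)) m j =
          evolve δ (initial bit q (word zro y z)) m j := by
      intro x y z j hj
      refine evolve_initial_congr δ bit q _ _ m j fun l hl _ => ?_
      have tail : ∀ x' : Fin k → Bool,
          (word x' y z)[l]? = (List.ofFn y ++ List.ofFn z)[l - k]? := by
        intro x'
        simp only [word, List.append_assoc]
        rw [List.getElem?_append_right (by simp only [List.length_ofFn]; omega),
          List.length_ofFn]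
      rw [tail, tail]
    have hPP : ∀ x z, P (word x y z) = P (word x y' z) := by
      intro x z
      have hlen : ∀ y, (word x y z).length = 2 * k + 2 ^ (2 * k) := by
        intro y
        simp only [word, List.length_append, List.length_ofFn]
        omega
      apply hbit
      rw [← hw _ (hlen y), ← hw _ (hlen y')]
      refine evolve_congr δ _ _ m k c fun j h1 h2 => ?_
      obtain ⟨d, rfl⟩ : ∃ d : Fin (2 * k + 1), j = c - k + d :=
        ⟨⟨(j - (c - k)).toNat, by omega⟩, by simp only []; omega⟩
      rcases lt_or_ge (c - k + d : ℤ) (k + m) with hd | hd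
      · rw [left x y z _ hd, left x y' z _ hd]
        exact congrFun (hx x) d
      · rw [right x y z _ hd, right x y' z _ hd]
        exact congrFun (hz z) d
    funext v
    obtain ⟨l, hl, hlv⟩ := exists_binVal_eq (2 * k) v v.2
    have entry : ∀ y : Fin (2 ^ (2 * k)) → Bool,
        y v = P (word (fun i => l[i]) y fun i => l[k + i]) := by
      intro y
      have hl' : (List.ofFn fun i : Fin k => l[i]) ++ (List.ofFn fun i : Fin k => l[k + i]) = l := by
        apply List.ext_getElem
        · simp only [List.length_append, List.length_ofFn]
          omega
        · intro i h1 h2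
          rw [List.getElem_append]
          split
          · simp
          · rename_i hi
            simp only [List.length_ofFn] at hi
            simp only [List.getElem_ofFn, List.length_ofFn]
            congr 1
            omega
      have := hP k (List.ofFn fun i : Fin k => l[i]) (List.ofFn y)
        (List.ofFn fun i : Fin k => l[k + i]) (by simp) (by simp) (by simp)
      rw [hl', hlv, List.getElem?_ofFn] at this
      simpa [word] using this
    rw [entry y, entry y', hPP]
  have hcard := Fintype.card_le_of_injective F hF
  simp only [Fintype.card_prod, Fintype.card_fun, Fintype.card_fin, Fintype.card_bool] at hcard
  refine hcard.trans ?_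
  gcongr

lemma IsIndexing.not_nonuniformASAPComputable {P : List Bool → Bool} (hP : IsIndexing P) :
    ¬ NonuniformASAPComputable P := by
  rintro ⟨s, hs⟩
  -- With `s ≤ 2 ^ s`, the bound on the number of tables at `k` reads
  -- `2 ^ k ≤ 2 * s * (2 * k + 1)`, which fails at `k = 2 * a` once `(a + 1) ^ 2` exceeds it.
  set a := 8 * s + 1 with ha
  set k := 2 * a with hk
  have h := two_pow_le_of_asapComputableWith hP (k := k) (by omega)
    (hs _ (by have := Nat.one_le_two_pow (n := 2 * k); omega))
  have h2 : ((s ^ (2 * k + 1)) ^ 2 ^ k) * ((s ^ (2 * k + 1)) ^ 2 ^ k) ≤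
      2 ^ (2 ^ k * (2 * s * (2 * k + 1))) := by
    have hs2 : s ≤ 2 ^ s := Nat.lt_two_pow_self.le
    calc _ ≤ (((2 ^ s) ^ (2 * k + 1)) ^ 2 ^ k) * (((2 ^ s) ^ (2 * k + 1)) ^ 2 ^ k) := by gcongr
      _ = _ := by
        rw [← pow_mul, ← pow_mul, ← pow_add]
        congr 1
        ring
  have h3 := (Nat.pow_le_pow_iff_right (by norm_num)).1 (h.trans h2)
  rw [two_mul k, pow_add] at h3
  have h4 : 2 ^ k ≤ 2 * s * (k + k + 1) := Nat.le_of_mul_le_mul_left h3 (by positivity)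
  have h5 : (a + 1) * (a + 1) ≤ 2 ^ k := by
    rw [hk, two_mul, pow_add]
    exact Nat.mul_le_mul Nat.lt_two_pow_self Nat.lt_two_pow_self
  nlinarith

/-! ### Machines with several stacks -/

/-- An operation on a stack of bits. -/
inductive StackOp
  | nop
  | pop
  | push (a : Bool)

namespace StackOp

/-- The effect of an operation on a stack; nothing happens if the empty stack is popped. -/
def apply : StackOp → List Bool → List Bool
  | nop, l => l
  | pop, l => l.tail
  | push a, l => a :: l

/-- The bit that is put on top of the stack. -/
def pushed : StackOp → Option Bool
  | push a => some a
  | _ => none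

/-- The effect of an operation on one place of a stack, where `l` and `r` are the contents of the
place above (or the pushed bit) and of the place below. -/
def shift : StackOp → Option Bool → Option Bool → Option Bool → Option Bool
  | nop, _, c, _ => c
  | pop, _, _, r => r
  | push _, l, _, _ => l

lemma getElem?_zero_apply (o : StackOp) (l : List Bool) :
    (o.apply l)[0]? = o.shift o.pushed l[0]? l[1]? := by
  cases o <;> simp [apply, shift, pushed]

lemma getElem?_succ_apply (o : StackOp) (l : List Bool) (i : ℕ) :
    (o.apply l)[i + 1]? = o.shift l[i]? l[i + 1]? l[i + 2]? := by
  cases o <;> simp [apply, shift]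

instance : Finite StackOp := by
  refine Finite.of_injective
    (fun o : StackOp =>
      (match o with
        | nop => none
        | pop => some none
        | push a => some (some a) : Option (Option Bool))) ?_
  rintro (_ | _ | a) (_ | _ | b) h <;> simp_all

end StackOp

/-- A deterministic machine with a finite control and with stacks of bits indexed by `ι`. -/
structure StackMachine (ι Q : Type) where
  /-- the initial state of the control -/
  start : Q
  /-- the stack that contains the input word at the start, with its first letter on top -/
  input : ι
  /-- the answer, in the states in which the machine halts -/
  output : Q → Option Bool
  /-- new state and stack operations, from the state and the tops of the stacks -/
  next : Q → (ι → Option Bool) → Q × (ι → StackOp)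

namespace StackMachine

variable {ι Q : Type} (M : StackMachine ι Q)

/-- One step of the machine; a configuration consists of a state and of the stacks. -/
def step (c : Q × (ι → List Bool)) : Q × (ι → List Bool) :=
  ((M.next c.1 fun j => (c.2 j)[0]?).1,
    fun j => ((M.next c.1 fun j => (c.2 j)[0]?).2 j).apply (c.2 j))

/-- The machine gets from `c` to `c'` in at most `t` steps, without halting on the way. -/
def Reaches (t : ℕ) (c c' : Q × (ι → List Bool)) : Prop :=
  ∃ m ≤ t, M.step^[m] c = c' ∧ ∀ i < m, M.output (M.step^[i] c).1 = none

variable {M}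

lemma Reaches.refl (c : Q × (ι → List Bool)) : M.Reaches 0 c c :=
  ⟨0, le_rfl, rfl, fun _ h => absurd h (Nat.not_lt_zero _)⟩

lemma Reaches.mono {t t' : ℕ} {c c' : Q × (ι → List Bool)} (h : M.Reaches t c c') (ht : t ≤ t') :
    M.Reaches t' c c' :=
  let ⟨m, hm, h⟩ := h
  ⟨m, hm.trans ht, h⟩

lemma Reaches.trans {t t' : ℕ} {c c' c'' : Q × (ι → List Bool)} (h : M.Reaches t c c')
    (h' : M.Reaches t' c' c'') : M.Reaches (t + t') c c'' := by
  obtain ⟨m, hm, rfl, ho⟩ := h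
  obtain ⟨m', hm', rfl, ho'⟩ := h'
  refine ⟨m' + m, by omega, Function.iterate_add_apply _ _ _ _, fun i hi => ?_⟩
  rcases lt_or_ge i m with him | him
  · exact ho i him
  · obtain ⟨d, rfl⟩ := Nat.exists_eq_add_of_le' him
    rw [Function.iterate_add_apply]
    exact ho' d (by omega)

lemma Reaches.head {t : ℕ} {q q' : Q} {s s' : ι → List Bool} {c : Q × (ι → List Bool)}
    (ho : M.output q = none) (hq : (M.next q fun j => (s j)[0]?).1 = q')
    (hs : ∀ j, ((M.next q fun j => (s j)[0]?).2 j).apply (s j) = s' j)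
    (h : M.Reaches t (q', s') c) : M.Reaches (t + 1) (q, s) c := by
  have hstep : M.step (q, s) = (q', s') := Prod.ext hq (funext hs)
  rw [add_comm]
  refine Reaches.trans ⟨1, le_rfl, hstep, fun i hi => ?_⟩ h
  obtain rfl : i = 0 := by omega
  exact ho

variable (M)

open Classical in
/-- The configuration at the start on the input word `w`. -/
noncomputable def init (w : List Bool) : Q × (ι → List Bool) :=
  (M.start, fun j => if j = M.input then w else [])

end StackMachine

/-! ### Simulation of a stack machine by a cellular automaton -/

/-- The states of a cellular automaton that simulates a stack machine. -/
inductive CellState (ι Q : Type)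
  /-- a cell that has not been used -/
  | neutral
  /-- the control of the stack machine in state `q`, about to issue stack operations if `act` -/
  | ctrl (act : Bool) (q : Q)
  /-- a cell that contains one place of each stack -/
  | idle (s : ι → Option Bool)
  /-- a cell that has just performed the operations `ops` on its place `old` of the stacks, with
  the result `new`, and passes the operations on to the right -/
  | active (ops : ι → StackOp) (old new : ι → Option Bool)

namespace CellState

variable {ι Q : Type}

/-- The entries of the stacks in a cell. -/
def content : CellState ι Q → ι → Option Bool
  | idle s => s
  | active _ _ new => new
  | _ => fun _ => none

instance [Finite ι] [Finite Q] : Finite (CellState ι Q) := by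
  refine Finite.of_surjective
    (fun x : Unit ⊕ (Bool × Q) ⊕ (ι → Option Bool) ⊕
        ((ι → StackOp) × (ι → Option Bool) × (ι → Option Bool)) =>
      (match x with
        | .inl _ => neutral
        | .inr (.inl p) => ctrl p.1 p.2
        | .inr (.inr (.inl s)) => idle s
        | .inr (.inr (.inr p)) => active p.1 p.2.1 p.2.2 : CellState ι Q)) ?_
  rintro (_ | ⟨act, q⟩ | s | ⟨o, s, s'⟩)
  exacts [⟨.inl (), rfl⟩, ⟨.inr (.inl (act, q)), rfl⟩, ⟨.inr (.inr (.inl s)), rfl⟩,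
    ⟨.inr (.inr (.inr (o, s, s'))), rfl⟩]

end CellState

namespace StackMachine

variable {ι Q : Type} (M : StackMachine ι Q)

open CellState

open Classical in
/-- An input bit, as a cell in which only the input stack has an entry. -/
noncomputable def bitState (b : Bool) : CellState ι Q :=
  idle fun j => if j = M.input then some b else none

/-- The new state of a cell other than the control when no operation arrives. An unused cell on the
left of the input becomes the control. -/
def restRule : CellState ι Q → CellState ι Q → CellState ι Q
  | neutral, idle _ => ctrl true M.start
  | active _ _ new, _ => idle new
  | c, _ => c

/-- The transition rule of the simulating automaton: the control issues operations in every second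
step, and they travel to the right with speed one. When the machine has halted, the cell on the
right of the control keeps showing the answer. -/
noncomputable def rule (l c r : CellState ι Q) : CellState ι Q :=
  match c with
  | ctrl true q =>
    match M.output q with
    | some _ => ctrl true q
    | none => ctrl false (M.next q r.content).1
  | ctrl false q => ctrl true q
  | c =>
    match l with
    | ctrl true q =>
      match M.output q with
      | some b => M.bitState b
      | none => active (M.next q c.content).2 c.content fun j =>
          ((M.next q c.content).2 j).shift ((M.next q c.content).2 j).pushed (c.content j)
            (r.content j)
    | active ops old _ => active ops c.content fun j =>
          (ops j).shift (old j) (c.content j) (r.content j)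
    | _ => M.restRule c r

/-- The cellular automaton that simulates a stack machine. Its control is in cell `-1`, and the
cell `i ≥ 0` contains the `i`-th entries of the stacks. -/
noncomputable def automaton [Finite ι] [Finite Q] : Automaton where
  State := CellState ι Q
  finite_state := inferInstance
  bit := M.bitState
  neutral := neutral
  bit_injective := by
    intro b b' h
    simp only [bitState, idle.injEq] at h
    simpa using congrFun h M.input
  bit_ne_neutral := by simp [bitState]
  rule := M.rule
  rule_neutral := rfl

variable {M}

lemma rule_issue {q : Q} (ho : M.output q = none) {c : CellState ι Q}
    (hc : ∀ a q, c ≠ ctrl a q) (r : CellState ι Q) :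
    M.rule (ctrl true q) c r = active (M.next q c.content).2 c.content fun j =>
      ((M.next q c.content).2 j).shift ((M.next q c.content).2 j).pushed (c.content j)
        (r.content j) := by
  cases c <;> simp_all [rule]

lemma rule_halted {q : Q} {b : Bool} (ho : M.output q = some b) {c : CellState ι Q}
    (hc : ∀ a q, c ≠ ctrl a q) (r : CellState ι Q) :
    M.rule (ctrl true q) c r = M.bitState b := by
  cases c <;> simp_all [rule]

lemma rule_active (ops : ι → StackOp) (old new : ι → Option Bool) {c : CellState ι Q}
    (hc : ∀ a q, c ≠ ctrl a q) (r : CellState ι Q) :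
    M.rule (active ops old new) c r = active ops c.content fun j =>
      (ops j).shift (old j) (c.content j) (r.content j) := by
  cases c <;> simp_all [rule]

lemma rule_rest {l c : CellState ι Q} (hl : ∀ q, l ≠ ctrl true q)
    (hl' : ∀ ops old new, l ≠ active ops old new)
    (hc : ∀ a q, c ≠ ctrl a q) (r : CellState ι Q) :
    M.rule l c r = M.restRule c r := by
  rcases l with _ | ⟨_ | _, _⟩ | _ | _ <;> cases c <;> simp_all [rule]

lemma content_initial (w : List Bool) (i : ℕ) :
    (initial M.bitState neutral w i).content = fun j => ((M.init w).2 j)[i]? := by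
  rw [initial_natCast]
  funext j
  by_cases hj : j = M.input <;> cases hi : w[i]? <;> simp [bitState, content, init, hj, hi]

lemma initial_ne_control (w : List Bool) (i : ℤ) (a : Bool) (q : Q) :
    initial M.bitState neutral w i ≠ ctrl a q := by
  rcases i with i | i
  · cases hi : w[i]? <;> simp [initial, bitState, hi]
  · simp [initial]

lemma initial_ne_active (w : List Bool) (i : ℤ) (o s s') :
    initial M.bitState neutral w i ≠ active o s s' := by
  rcases i with i | i
  · cases hi : w[i]? <;> simp [initial, bitState, hi]
  · simp [initial]

/-- In the input and on its right, the initial configuration is at rest. -/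
lemma restRule_initial (w : List Bool) (i : ℕ) :
    M.restRule (initial M.bitState neutral w i) (initial M.bitState neutral w (i + 1 : ℕ)) =
      initial M.bitState neutral w i := by
  rw [initial_natCast, initial_natCast]
  cases hi : w[i]? with
  | some b => simp [bitState, restRule]
  | none =>
    have : w[i + 1]? = none := by
      rw [List.getElem?_eq_none_iff] at hi ⊢
      omega
    simp [restRule, this]

variable (M) in
/-- State of cell `i` at time `t` in the simulation of `M` on the input word `w`. -/
noncomputable def cell (w : List Bool) (t : ℕ) (i : ℤ) : CellState ι Q :=
  evolve (fun _ _ => M.rule) (initial M.bitState neutral w) t i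

lemma cell_zero (w : List Bool) (i : ℤ) : M.cell w 0 i = initial M.bitState neutral w i := rfl

lemma cell_succ (w : List Bool) (t : ℕ) (i : ℤ) :
    M.cell w (t + 1) i = M.rule (M.cell w t (i - 1)) (M.cell w t i) (M.cell w t (i + 1)) := rfl

/-- The configurations of the automaton at time `t + 1`: the control has reached the machine
configuration at time `⌈t / 2⌉`, and the cell `i` performs the step `T` of the machine at time
`2 * T + i + 1`. -/
structure Simulates (w : List Bool) (t : ℕ) : Prop where
  control_act : ∀ T, t = 2 * T →
    M.cell w (t + 1) (-1) = ctrl true (M.step^[T] (M.init w)).1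
  control_wait : ∀ T, t = 2 * T + 1 →
    M.cell w (t + 1) (-1) = ctrl false (M.step^[T + 1] (M.init w)).1
  untouched : ∀ i : ℕ, t ≤ i → M.cell w (t + 1) i = initial M.bitState neutral w i
  performing : ∀ i T : ℕ, t = 2 * T + i + 1 → M.cell w (t + 1) i =
    active (M.next (M.step^[T] (M.init w)).1 fun j => ((M.step^[T] (M.init w)).2 j)[0]?).2
      (fun j => ((M.step^[T] (M.init w)).2 j)[i]?)
      (fun j => ((M.step^[T + 1] (M.init w)).2 j)[i]?)
  resting : ∀ i T : ℕ, t = 2 * T + i + 2 → M.cell w (t + 1) i =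
    idle fun j => ((M.step^[T + 1] (M.init w)).2 j)[i]?

namespace Simulates

variable {w : List Bool} {t : ℕ}

lemma ne_control (h : M.Simulates w t) (i : ℕ) (a : Bool) (q : Q) :
    M.cell w (t + 1) i ≠ ctrl a q := by
  rcases le_or_gt t i with hi | hi
  · rw [h.untouched i hi]
    exact initial_ne_control w i a q
  obtain ⟨T, hT | hT⟩ : ∃ T, t = 2 * T + i + 1 ∨ t = 2 * T + i + 2 :=
    ⟨(t - i - 1) / 2, by omega⟩
  · rw [h.performing i T hT]
    simp
  · rw [h.resting i T hT]
    simp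

lemma content_eq (h : M.Simulates w t) {i T : ℕ} (hT : t = 2 * T + i ∨ t + 1 = 2 * T + i) :
    (M.cell w (t + 1) i).content = fun j => ((M.step^[T] (M.init w)).2 j)[i]? := by
  rcases T with _ | T
  · rw [h.untouched i (by omega)]
    exact content_initial w i
  rcases hT with hT | hT
  · rw [h.resting i T (by omega)]
    rfl
  · rw [h.performing i T (by omega)]
    rfl

end Simulates

lemma simulates_zero {w : List Bool} (hw : w ≠ []) : M.Simulates w 0 where
  control_act T hT := by
    obtain rfl : T = 0 := by omega
    obtain ⟨b, w, rfl⟩ := List.exists_cons_of_ne_nil hw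
    rfl
  control_wait T hT := by omega
  performing i T hT := by omega
  resting i T hT := by omega
  untouched i _ := by
    rw [cell_succ, cell_zero, cell_zero, cell_zero,
      rule_rest (fun q => initial_ne_control _ _ _ q) (initial_ne_active _ _)
      (initial_ne_control _ _)]
    exact restRule_initial w i

lemma Simulates.succ {w : List Bool} {t : ℕ} (h : M.Simulates w t)
    (ho : ∀ T, t = 2 * T → M.output (M.step^[T] (M.init w)).1 = none) :
    M.Simulates w (t + 1) where
  control_act T hT := by
    obtain ⟨T, rfl⟩ : ∃ T', T = T' + 1 := ⟨T - 1, by omega⟩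
    rw [cell_succ, h.control_wait T (by omega)]
    rfl
  control_wait T hT := by
    have hc := h.content_eq (i := 0) (T := T) (by omega)
    rw [cell_succ, h.control_act T (by omega)]
    simp only [rule, ho T (by omega)]
    rw [show (-1 + 1 : ℤ) = (0 : ℕ) from rfl, hc, Function.iterate_succ_apply']
    rfl
  untouched i hi := by
    rw [cell_succ, ← Nat.cast_add_one, h.untouched i (by omega),
      h.untouched (i + 1) (by omega)]
    obtain ⟨i, rfl⟩ : ∃ i', i = i' + 1 := ⟨i - 1, by omega⟩
    rw [show (((i + 1 : ℕ) : ℤ) - 1) = (i : ℕ) by push_cast; ring, h.untouched i (by omega),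
      rule_rest (fun q => initial_ne_control _ _ _ q) (initial_ne_active _ _)
      (initial_ne_control _ _)]
    exact restRule_initial w (i + 1)
  performing i T hT := by
    have hc := h.content_eq (i := i) (T := T) (by omega)
    have hr := h.content_eq (i := i + 1) (T := T) (by omega)
    rw [cell_succ, ← Nat.cast_add_one, Function.iterate_succ_apply']
    rcases i with _ | i
    · rw [show (((0 : ℕ) : ℤ) - 1) = -1 from rfl, h.control_act T (by omega),
        rule_issue (ho T (by omega)) (h.ne_control 0), hc, hr]
      simp only [step, StackOp.getElem?_zero_apply]
    · rw [show (((i + 1 : ℕ) : ℤ) - 1) = (i : ℕ) by push_cast; ring,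
        h.performing i T (by omega), rule_active _ _ _ (h.ne_control (i + 1)), hc, hr]
      simp only [step, StackOp.getElem?_succ_apply]
  resting i T hT := by
    rw [cell_succ, h.performing i T (by omega)]
    refine rule_rest ?_ ?_ (by simp) _
    · rcases i with _ | i
      · rw [show (((0 : ℕ) : ℤ) - 1) = -1 from rfl, h.control_wait T (by omega)]
        simp
      · rw [show (((i + 1 : ℕ) : ℤ) - 1) = (i : ℕ) by push_cast; ring]
        exact h.ne_control i true
    · rcases i with _ | i
      · rw [show (((0 : ℕ) : ℤ) - 1) = -1 from rfl, h.control_wait T (by omega)]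
        simp
      · rw [show (((i + 1 : ℕ) : ℤ) - 1) = (i : ℕ) by push_cast; ring,
          h.resting i T (by omega)]
        simp

/-- If the stack machine halts after at most `T` steps, then the automaton shows the answer in the
first input cell from time `2 * T + 2` on. -/
lemma automaton_run_eq_bit [Finite ι] [Finite Q] {w : List Bool} (hw : w ≠ []) {T : ℕ}
    {c : Q × (ι → List Bool)} {b : Bool} (h : M.Reaches T (M.init w) c) (hb : M.output c.1 = some b) {t : ℕ}
    (ht : 2 * T + 2 ≤ t) : M.automaton.run w t 0 = M.automaton.bit b := by
  change M.cell w t 0 = M.bitState b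
  obtain ⟨m, hm, rfl, ho⟩ := h
  have hsim : ∀ t ≤ 2 * m, M.Simulates w t := by
    intro t
    induction t with
    | zero => exact fun _ => simulates_zero hw
    | succ t ih => exact fun ht => (ih (by omega)).succ fun T hT => ho T (by omega)
  have hhalt : ∀ d, M.cell w (2 * m + 1 + d) (-1) =
      ctrl true (M.step^[m] (M.init w)).1 ∧
      ∀ a q, M.cell w (2 * m + 1 + d) 0 ≠ ctrl a q := by
    intro d
    induction d with
    | zero => exact ⟨(hsim _ le_rfl).control_act m rfl, (hsim _ le_rfl).ne_control 0⟩
    | succ d ih =>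
      rw [← add_assoc, cell_succ, cell_succ, zero_sub, ih.1,
        rule_halted hb ih.2]
      exact ⟨by simp [rule, hb], by simp [bitState]⟩
  obtain ⟨d, rfl⟩ := Nat.exists_eq_add_of_le (show 2 * m + 2 ≤ t by omega)
  rw [show 2 * m + 2 + d = 2 * m + 1 + d + 1 by ring, cell_succ, zero_sub,
    (hhalt d).1, rule_halted hb (hhalt d).2]

end StackMachine

/-! ### A stack machine for indexing -/

/-- The control states of the stack machine for indexing. -/
inductive Phase
  /-- the input is reversed, and its length is noted in unary notation -/
  | load
  /-- a number is divided by four; `i` is the current remainder -/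
  | quarter (i : Fin 4)
  /-- the quotient is moved to the place of the dividend -/
  | unquarter
  /-- the last letters of the input are separated -/
  | takeSuffix
  /-- the rest of the input is reversed again -/
  | unload
  /-- the first letters of the input are separated -/
  | takePrefix
  /-- the first and the last letters are concatenated -/
  | join
  /-- a digit is appended to the binary notation of the index -/
  | digit
  /-- the index is moved before it is doubled; `b` is the digit to be appended -/
  | move (b : Bool)
  /-- the index is moved back, and doubled, and `b` is added -/
  | double (b : Bool)
  /-- one half of the doubling for one unit of the index -/
  | again (b : Bool)
  /-- the entry with the given index is sought in the table -/
  | look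
  /-- the answer has been found -/
  | halt (b : Bool)

instance : Finite Phase := by
  refine Finite.of_injective
    (fun p : Phase => (match p with
      | .load => (0, 0, false) | .quarter i => (1, i, false) | .unquarter => (2, 0, false)
      | .takeSuffix => (3, 0, false) | .unload => (4, 0, false) | .takePrefix => (5, 0, false)
      | .join => (6, 0, false) | .digit => (7, 0, false) | .move b => (8, 0, b)
      | .double b => (9, 0, b) | .again b => (10, 0, b) | .look => (11, 0, false)
      | .halt b => (12, 0, b) : Fin 13 × Fin 4 × Bool)) ?_
  intro p p' h
  cases p <;> cases p' <;> simp_all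

/-- The number of base-four digits, minus one, of the length of `w`: the length `k` of the two
halves of the index in the indexing problem. -/
def indexWidth (w : List Bool) : ℕ := Nat.log 4 w.length

/-- The indexing predicate on all words: if the letters of `w` except for the last `k` ones are `v`,
then the index consists of the first `k` letters of `v` and the last `k` letters of `w`, and the
table is `v` without its first `k` letters. The value is `false` if the index is too large. -/
def indexing (w : List Bool) : Bool :=
  let k := indexWidth w
  let v := w.take (w.length - k)
  ((v.drop k)[binVal (v.take k ++ w.drop (w.length - k))]?).getD false

lemma isIndexing_indexing : IsIndexing indexing := by
  intro k x y z hx hy hz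
  have hlen : (x ++ y ++ z).length = 2 ^ (2 * k) + 2 * k := by
    simp only [List.length_append]
    omega
  have hwidth : indexWidth (x ++ y ++ z) = k := by
    have h := Nat.lt_pow_self (n := 2 * k) (a := 2) (by norm_num)
    rw [indexWidth, hlen]
    apply Nat.log_eq_of_pow_le_of_lt_pow
    · rw [pow_mul]; norm_num
    · rw [pow_succ, show 4 = 2 ^ 2 by norm_num, ← pow_mul]
      omega
  have hcut : (x ++ y ++ z).length - k = (x ++ y).length := by
    simp only [List.length_append]
    omega
  have hlt : binVal (x ++ z) < y.length := by
    have h := binVal_lt (x ++ z)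
    rwa [List.length_append, hx, hz, ← two_mul, ← hy] at h
  simp only [indexing, hwidth, hcut]
  rw [List.take_left, List.drop_left, ← hx, List.take_left, List.drop_left,
    List.getElem?_eq_getElem hlt]
  rfl

open StackOp in
/-- A stack machine for indexing. The stacks `0` and `1` contain the input and its reversal; the
numbers, in unary notation, on the stacks `2`, `3`, `4` are the dividend, the quotient, and the
number of divisions when the logarithm of the length of the input is computed. Then stack `3` is
used for the binary digits of the index, and stack `4` for its unary notation. -/
def indexer : StackMachine (Fin 5) Phase where
  start := .load
  input := 0
  output
    | .halt b => some b
    | _ => none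
  next
    | .load, s =>
      match s 0 with
      | some b => (.load, ![pop, push b, push true, nop, nop])
      | none => (.quarter 0, fun _ => nop)
    | .quarter i, s =>
      match s 2 with
      | some _ => (.quarter (i + 1), ![nop, nop, pop, if i = 3 then push true else nop, nop])
      | none =>
        match s 3 with
        | some _ => (.unquarter, ![nop, nop, nop, nop, push true])
        | none => (.takeSuffix, fun _ => nop)
    | .unquarter, s =>
      match s 3 with
      | some _ => (.unquarter, ![nop, nop, push true, pop, nop])
      | none => (.quarter 0, fun _ => nop)
    | .takeSuffix, s =>
      match s 4 with
      | some _ => (.takeSuffix, ![nop, pop, push true, push ((s 1).getD false), pop])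
      | none => (.unload, fun _ => nop)
    | .unload, s =>
      match s 1 with
      | some b => (.unload, ![push b, pop, nop, nop, nop])
      | none => (.takePrefix, fun _ => nop)
    | .takePrefix, s =>
      match s 2 with
      | some _ => (.takePrefix, ![pop, push ((s 0).getD false), pop, nop, nop])
      | none => (.join, fun _ => nop)
    | .join, s =>
      match s 1 with
      | some b => (.join, ![nop, pop, nop, push b, nop])
      | none => (.digit, fun _ => nop)
    | .digit, s =>
      match s 3 with
      | some b => (.move b, ![nop, nop, nop, pop, nop])
      | none => (.look, fun _ => nop)
    | .move b, s =>
      match s 4 with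
      | some _ => (.move b, ![nop, push true, nop, nop, pop])
      | none => (.double b, fun _ => nop)
    | .double b, s =>
      match s 1 with
      | some _ => (.again b, ![nop, pop, nop, nop, push true])
      | none => (.digit, ![nop, nop, nop, nop, if b then push true else nop])
    | .again b, _ => (.double b, ![nop, nop, nop, nop, push true])
    | .look, s =>
      match s 4 with
      | some _ => (.look, ![pop, nop, nop, nop, pop])
      | none => (.halt ((s 0).getD false), fun _ => nop)
    | .halt b, _ => (.halt b, fun _ => nop)

namespace indexer

open List StackMachine Phase

local notation "marks" => fun n : ℕ => List.replicate n true

lemma init_eq (w : List Bool) : indexer.init w = (load, ![w, [], [], [], []]) := by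
  refine Prod.ext rfl (funext fun j => ?_)
  fin_cases j <;> simp [StackMachine.init, indexer]

lemma reaches_load (v k : List Bool) (w a : List Bool) (n : ℕ) :
    indexer.Reaches (w.length + 1) (load, ![w, a, marks n, v, k])
      (quarter 0, ![[], w.reverse ++ a, marks (w.length + n), v, k]) := by
  induction w generalizing a n with
  | nil =>
    refine .head rfl rfl (fun j => ?_) (.refl _)
    fin_cases j <;> simp [indexer, StackOp.apply]
  | cons b w ih =>
    have := ih (b :: a) (n + 1)
    rw [show w.length + (n + 1) = (b :: w).length + n by simp; ring] at this
    rw [reverse_cons, append_assoc]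
    refine .head rfl rfl (fun j => ?_) this
    fin_cases j <;> rfl

lemma exists_reaches_quarter (b k : List Bool) (m : ℕ) (i : Fin 4) (v : ℕ) :
    ∃ i', indexer.Reaches m (quarter i, ![[], b, marks m, marks v, k])
      (quarter i', ![[], b, [], marks (v + (i + m) / 4), k]) := by
  induction m generalizing i v with
  | zero =>
    refine ⟨i, ?_⟩
    rw [show v + ((i : ℕ) + 0) / 4 = v by omega]
    exact .refl _
  | succ m ih =>
    obtain ⟨i', h⟩ := ih (i + 1) (if i = 3 then v + 1 else v)
    refine ⟨i', ?_⟩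
    have hv : (if i = 3 then v + 1 else v) + (((i + 1 : Fin 4) : ℕ) + m) / 4 =
        v + ((i : ℕ) + (m + 1)) / 4 := by
      fin_cases i <;> simp <;> omega
    rw [hv] at h
    refine .head rfl rfl (fun j => ?_) h
    fin_cases i <;> fin_cases j <;> rfl

lemma reaches_unquarter (a b k : List Bool) (v m : ℕ) :
    indexer.Reaches (v + 1) (unquarter, ![a, b, marks m, marks v, k])
      (quarter 0, ![a, b, marks (v + m), [], k]) := by
  induction v generalizing m with
  | zero =>
    rw [zero_add m]
    refine .head rfl rfl (fun j => ?_) (.refl _)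
    fin_cases j <;> rfl
  | succ v ih =>
    have := ih (m + 1)
    rw [show v + (m + 1) = v + 1 + m by ring] at this
    refine .head rfl rfl (fun j => ?_) this
    fin_cases j <;> rfl

lemma reaches_log (b : List Bool) (n k : ℕ) :
    indexer.Reaches (3 * n + 2) (quarter 0, ![[], b, marks n, [], marks k])
      (takeSuffix, ![[], b, [], [], marks (Nat.log 4 n + k)]) := by
  induction n using Nat.strong_induction_on generalizing k with
  | _ n ih =>
    obtain ⟨i, h⟩ := exists_reaches_quarter b (marks k) n 0 0
    simp only [Fin.val_zero, zero_add] at h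
    rcases lt_or_ge n 4 with hn | hn
    · rw [Nat.log_of_lt hn, zero_add]
      rw [Nat.div_eq_of_lt hn] at h
      refine (h.trans (t' := 1) (.head rfl rfl (fun j => ?_) (.refl _))).mono (by omega)
      fin_cases j <;> rfl
    · rw [Nat.log_of_one_lt_of_le (by norm_num) hn, add_assoc, add_comm 1]
      obtain ⟨m, hm⟩ : ∃ m, n / 4 = m + 1 := ⟨n / 4 - 1, by omega⟩
      have h' := (reaches_unquarter [] b (marks (k + 1)) (n / 4) 0).trans
        (ih (n / 4) (by omega) (k + 1))
      rw [hm] at h h' ⊢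
      refine (h.trans (.head rfl rfl (fun j => ?_) h')).mono (by omega)
      fin_cases j <;> rfl

lemma reaches_takeSuffix (a r : List Bool) (l : List Bool) (m : ℕ) (v : List Bool) :
    indexer.Reaches (l.length + 1) (takeSuffix, ![a, l ++ r, marks m, v, marks l.length])
      (unload, ![a, r, marks (l.length + m), l.reverse ++ v, []]) := by
  induction l generalizing m v with
  | nil =>
    rw [length_nil, zero_add m]
    refine .head rfl rfl (fun j => ?_) (.refl _)
    fin_cases j <;> rfl
  | cons c l ih =>
    have := ih (m + 1) (c :: v)
    rw [show l.length + (m + 1) = (c :: l).length + m by simp; ring] at this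
    rw [reverse_cons, append_assoc]
    refine .head rfl rfl (fun j => ?_) this
    fin_cases j <;> rfl

lemma reaches_unload (u v k : List Bool) (b a : List Bool) :
    indexer.Reaches (b.length + 1) (unload, ![a, b, u, v, k])
      (takePrefix, ![b.reverse ++ a, [], u, v, k]) := by
  induction b generalizing a with
  | nil =>
    refine .head rfl rfl (fun j => ?_) (.refl _)
    fin_cases j <;> rfl
  | cons c b ih =>
    rw [reverse_cons, append_assoc]
    refine .head rfl rfl (fun j => ?_) (ih (c :: a))
    fin_cases j <;> rfl

lemma reaches_takePrefix (r v k : List Bool) (l b : List Bool) :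
    indexer.Reaches (l.length + 1) (takePrefix, ![l ++ r, b, marks l.length, v, k])
      (join, ![r, l.reverse ++ b, [], v, k]) := by
  induction l generalizing b with
  | nil =>
    refine .head rfl rfl (fun j => ?_) (.refl _)
    fin_cases j <;> rfl
  | cons c l ih =>
    rw [reverse_cons, append_assoc]
    refine .head rfl rfl (fun j => ?_) (ih (c :: b))
    fin_cases j <;> rfl

lemma reaches_join (a u k : List Bool) (b v : List Bool) :
    indexer.Reaches (b.length + 1) (join, ![a, b, u, v, k])
      (digit, ![a, [], u, b.reverse ++ v, k]) := by
  induction b generalizing v with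
  | nil =>
    refine .head rfl rfl (fun j => ?_) (.refl _)
    fin_cases j <;> rfl
  | cons c b ih =>
    rw [reverse_cons, append_assoc]
    refine .head rfl rfl (fun j => ?_) (ih (c :: v))
    fin_cases j <;> rfl

lemma reaches_move (d : Bool) (a u v : List Bool) (n m : ℕ) :
    indexer.Reaches (n + 1) (move d, ![a, marks m, u, v, marks n])
      (double d, ![a, marks (n + m), u, v, []]) := by
  induction n generalizing m with
  | zero =>
    rw [zero_add m]
    refine .head rfl rfl (fun j => ?_) (.refl _)
    fin_cases j <;> rfl
  | succ n ih =>
    have := ih (m + 1)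
    rw [show n + (m + 1) = n + 1 + m by ring] at this
    refine .head rfl rfl (fun j => ?_) this
    fin_cases j <;> rfl

lemma reaches_double (d : Bool) (a u v : List Bool) (m n : ℕ) :
    indexer.Reaches (2 * m + 1) (double d, ![a, marks m, u, v, marks n])
      (digit, ![a, [], u, v, marks (2 * m + n + d.toNat)]) := by
  induction m generalizing n with
  | zero =>
    rw [mul_zero, zero_add n]
    refine .head rfl rfl (fun j => ?_) (.refl _)
    cases d <;> fin_cases j <;> rfl
  | succ m ih =>
    have := ih (n + 2)
    rw [show 2 * m + (n + 2) = 2 * (m + 1) + n by ring] at this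
    refine .head (t := 2 * m + 1 + 1) (q' := again d)
      (s' := ![a, marks m, u, v, marks (n + 1)]) rfl rfl (fun j => ?_)
      (.head rfl rfl (fun j => ?_) this) <;>
    fin_cases j <;> rfl

/-- Since the index at least doubles unless it is zero, its final value bounds the time that is
spent in all the doublings; the summand `3 * n` makes the estimate inductive. -/
lemma exists_reaches_digit (a u : List Bool) (l : List Bool) (n : ℕ) :
    ∃ t, t + 3 * n ≤ 3 * l.foldl (fun v b => 2 * v + b.toNat) n + 3 * l.length + 1 ∧
      indexer.Reaches t (digit, ![a, [], u, l, marks n])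
        (look, ![a, [], u, [], marks (l.foldl (fun v b => 2 * v + b.toNat) n)]) := by
  induction l generalizing n with
  | nil =>
    refine ⟨1, by simp; omega, .head rfl rfl (fun j => ?_) (.refl _)⟩
    fin_cases j <;> rfl
  | cons d l ih =>
    obtain ⟨t, ht, h⟩ := ih (2 * n + d.toNat)
    refine ⟨(n + 1) + ((2 * n + 1) + t) + 1, ?_, .head rfl rfl (fun j => ?_)
      ((reaches_move d a u l n 0).trans ((reaches_double d a u l n 0).trans h))⟩
    · rw [foldl_cons, length_cons]
      omega
    · fin_cases j <;> rfl

lemma exists_reaches_look (n : ℕ) (a : List Bool) :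
    ∃ c, indexer.output c.1 = some (a[n]?.getD false) ∧
      indexer.Reaches (n + 1) (look, ![a, [], [], [], marks n]) c := by
  induction n generalizing a with
  | zero =>
    refine ⟨(_, _), ?_, .head rfl rfl (fun _ => rfl) (.refl _)⟩
    rfl
  | succ n ih =>
    obtain ⟨c, hc, h⟩ := ih a.tail
    rw [getElem?_tail] at hc
    refine ⟨c, hc, .head rfl rfl (fun j => ?_) h⟩
    fin_cases j <;> rfl

lemma two_mul_indexWidth_lt (w : List Bool) (hw : w ≠ []) : 2 * indexWidth w < w.length := by
  have h1 : 4 ^ indexWidth w ≤ w.length :=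
    Nat.pow_log_le_self 4 (List.length_pos_iff.2 hw).ne'
  rw [show 4 = 2 ^ 2 by norm_num, ← pow_mul] at h1
  exact Nat.lt_two_pow_self.trans_le h1

/-- The stack machine computes the indexing predicate in linear time. -/
lemma exists_reaches_output {w : List Bool} (hw : w ≠ []) :
    ∃ c, indexer.output c.1 = some (indexing w) ∧
      indexer.Reaches (24 * w.length) (indexer.init w) c := by
  have hk := two_mul_indexWidth_lt w hw
  set n := w.length with hn
  set k := indexWidth w with hkw
  set v := w.take (n - k) with hv
  set z := w.drop (n - k) with hz
  have hvz : v ++ z = w := take_append_drop _ _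
  have hvlen : v.length = n - k := by rw [hv, length_take]; omega
  have hzlen : z.length = k := by rw [hz, length_drop]; omega
  have hxlen : (v.take k).length = k := by rw [length_take]; omega
  set i := binVal (v.take k ++ z) with hi
  have hin : i < n := by
    refine (binVal_lt _).trans_le ?_
    rw [length_append, hxlen, hzlen, ← two_mul, pow_mul]
    exact Nat.pow_log_le_self 4 (by omega)
  have h1 := reaches_load [] [] w [] 0
  have h2 := reaches_log (w.reverse ++ []) n 0
  have h3 := reaches_takeSuffix [] v.reverse z.reverse 0 []
  have h4 := reaches_unload (marks k) z [] v.reverse []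
  have h5 := reaches_takePrefix (v.drop k) z [] (v.take k) []
  have h6 := reaches_join (v.drop k) [] [] (v.take k).reverse z
  obtain ⟨t, ht, h7⟩ := exists_reaches_digit (v.drop k) [] (v.take k ++ z) 0
  obtain ⟨c, hc, h8⟩ := exists_reaches_look i (v.drop k)
  rw [← hn, add_zero, append_nil] at h1
  rw [append_nil, add_zero, show Nat.log 4 n = k from rfl] at h2
  rw [← reverse_append, hvz, length_reverse, hzlen, add_zero, append_nil, reverse_reverse] at h3
  rw [length_reverse, hvlen, append_nil, reverse_reverse] at h4
  rw [take_append_drop, hxlen, append_nil] at h5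
  rw [length_reverse, hxlen, reverse_reverse] at h6
  change t + 0 ≤ 3 * i + _ + 1 at ht
  rw [length_append, hxlen, hzlen] at ht
  rw [init_eq]
  refine ⟨c, hc, ?_⟩
  refine (h1.trans (h2.trans (h3.trans (h4.trans (h5.trans (h6.trans (h7.trans h8))))))).mono ?_
  omega

end indexer

lemma linearTimeComputable_indexing : LinearTimeComputable indexing := by
  refine ⟨indexer.automaton, 50, fun w hw t ht => ?_⟩
  obtain ⟨c, hc, h⟩ := indexer.exists_reaches_output hw
  have := List.length_pos_iff.2 hw
  exact StackMachine.automaton_run_eq_bit hw h hc (by omega)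

end CellAut

theorem theorem5 :
    (∃ P : List Bool → Bool, CellAut.IsIndexing P ∧ CellAut.LinearTimeComputable P ∧
      ¬ CellAut.NonuniformASAPComputable P) ∧
    (∀ P : List Bool → Bool, CellAut.IsIndexing P → ¬ CellAut.NonuniformASAPComputable P) :=
  ⟨⟨CellAut.indexing, CellAut.isIndexing_indexing, CellAut.linearTimeComputable_indexing,
    CellAut.isIndexing_indexing.not_nonuniformASAPComputable⟩,
    fun _ hP => hP.not_nonuniformASAPComputable⟩
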